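/- An atom of a monoid $M$ is an element $a\ne 1$ such that $a=bc$ implies $b=1$ or $c=1$; $\|a\|$ is the supremum of the lengths of all expressions of $a$ as a product of atoms; $M$ is atomic if it is generated by its atoms and $\|a\|<\infty$ for all $a\in M$. Write $a\le_L b$ if $ac=b$ for some $c\in M$, and $a\le_R b$ if $ca=b$ for some $c\in M$. A Garside element of $M$ is an element $\Delta$ such that $a\le_L\Delta\Leftrightarrow a\le_R\Delta$ for all $a\in M$ and $\{a\in M: a\le_L\Delta\}$ generates $M$. A Garside monoid is an atomic, finitely generated, left and right cancellative monoid $M$ such that $(M,\le_L)$ and $(M,\le_R)$ are lattices and $M$ has a Garside element. A Garside group is the group of fractions $G$ of a Garside monoid $M$, that is, a group $G\supseteq M$ in which every element has the form $ab^{-1}$ with $a,b\in M$. Let $G$ be the group of fractions of a Garside monoid $M$ and let $\Delta$ be a Garside element of $M$. For $g,h\in G$ write $g\le_L h$ if $gc=h$ for some $c\in M$, and put $$\inf(g)=\max\{r\in\mathbb Z:\Delta^r\le_L g\},\qquad \sup(g)=\min\{s\in\mathbb Z: g\le_L\Delta^s\},$$ $$t_{\inf}(g)=\lim_{n\to\infty}\frac{\inf(g^n)}{n},\qquad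 t_{\sup}(g)=\lim_{n\to\infty}\frac{\sup(g^n)}{n}$$ (these exist; in the degenerate case $M=\{1\}$, where the maximum and the minimum do not exist, put $\inf(1)=\sup(1)=0$). An element $h\in G$ is inf-straight if $\inf(h)=t_{\inf}(h)$ and sup-straight if $\sup(h)=t_{\sup}(h)$. Then for every $g\in G$: (i) $g$ is conjugate in $G$ to an inf-straight element if and only if $t_{\inf}(g)$ is an integer; (ii) $g$ is conjugate in $G$ to a sup-straight element if and only if $t_{\sup}(g)$ is an integer. -/

import Mathlib

open Filter Topology

namespace Garside

section Monoids

variable {M : Type*} [Monoid M]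

/-- Atoms: the elements `a ≠ 1` such that `a = b * c` forces `b = 1` or `c = 1`. -/
def IsAtomElt (a : M) : Prop :=
  a ≠ 1 ∧ ∀ b c : M, a = b * c → b = 1 ∨ c = 1

/-- `‖a‖`: the supremum, in `ℕ∞`, of the lengths of all expressions of `a` as a product of
atoms. -/
noncomputable def atomNorm (a : M) : ℕ∞ :=
  ⨆ (l : List M) (_ : (∀ x ∈ l, IsAtomElt x) ∧ l.prod = a), (l.length : ℕ∞)

/-- `a ≤_L b`: `b = a * c` for some `c`. -/
def LeL (a b : M) : Prop := ∃ c : M, a * c = b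

/-- `a ≤_R b`: `b = c * a` for some `c`. -/
def LeR (a b : M) : Prop := ∃ c : M, c * a = b

/-- Every pair of elements has a greatest lower bound and a least upper bound for `r`. -/
def HasMeetsJoins {X : Type*} (r : X → X → Prop) : Prop :=
  ∀ a b : X,
    (∃ m, r m a ∧ r m b ∧ ∀ c, r c a → r c b → r c m) ∧
    (∃ j, r a j ∧ r b j ∧ ∀ c, r a c → r b c → r j c)

/-- A Garside element of a monoid `M`: its left and right divisors coincide, and they
generate `M`. -/
structure IsGarsideElement (Δ : M) : Prop where
  leL_iff_leR : ∀ a : M, LeL a Δ ↔ LeR a Δ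
  closure_simples : Submonoid.closure {a : M | LeL a Δ} = ⊤

end Monoids

/-- A monoid is atomic if it is generated by its atoms and `‖a‖ < ∞` for all `a`. -/
structure IsAtomicMonoid (M : Type*) [Monoid M] : Prop where
  closure_atoms : Submonoid.closure {a : M | IsAtomElt a} = ⊤
  atomNorm_lt_top : ∀ a : M, atomNorm a < ⊤

/-- Garside monoids. (In an atomic monoid `LeL` and `LeR` are partial orders, so the fields
`meets_joins_L`, `meets_joins_R` say that they are lattice orders; see `LeL.antisymm`,
`LeR.antisymm`.) -/
structure IsGarsideMonoid (M : Type*) [Monoid M] : Prop where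
  atomic : IsAtomicMonoid M
  fg : Monoid.FG M
  cancel : IsCancelMul M
  meets_joins_L : HasMeetsJoins (LeL : M → M → Prop)
  meets_joins_R : HasMeetsJoins (LeR : M → M → Prop)
  exists_garside : ∃ Δ : M, IsGarsideElement Δ

/-- `G` is, through `ι`, the group of fractions of `M`: `ι` embeds the monoid `M` in the group
`G`, and every element of `G` is a fraction `a b⁻¹` with `a`, `b` in `M`. -/
structure IsGroupOfFractions {M G : Type*} [Monoid M] [Group G] (ι : M →* G) : Prop where
  injective : Function.Injective ι
  exists_fraction : ∀ g : G, ∃ a b : M, g = ι a * (ι b)⁻¹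

section Groups

variable {M G : Type*} [Monoid M] [Group G]

/-- The extension of `≤_L` to the group of fractions: `g ≤_L h` if `h = g c` with `c` positive,
that is, in the image of `M`. -/
def GLeL (ι : M →* G) (g h : G) : Prop := ∃ c : M, g * ι c = h

/-- `inf g = max {r ∈ ℤ : Δ^r ≤_L g}`. The maximum exists if `M` is nontrivial, see
`isGreatest_ginf`. -/
noncomputable def ginf (ι : M →* G) (Δ : M) (g : G) : ℤ :=
  sSup {r : ℤ | GLeL ι (ι Δ ^ r) g}

/-- `sup g = min {s ∈ ℤ : g ≤_L Δ^s}`. The minimum exists if `M` is nontrivial, see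
`isLeast_gsup`. -/
noncomputable def gsup (ι : M →* G) (Δ : M) (g : G) : ℤ :=
  sInf {s : ℤ | GLeL ι g (ι Δ ^ s)}

/-- `t_inf g = lim inf(g^n) / n`. The limit exists, see `tendsto_tInf`. -/
noncomputable def tInf (ι : M →* G) (Δ : M) (g : G) : ℝ :=
  limUnder atTop (fun n : ℕ => (ginf ι Δ (g ^ n) : ℝ) / n)

/-- `t_sup g = lim sup(g^n) / n`. The limit exists, see `tendsto_tSup`. -/
noncomputable def tSup (ι : M →* G) (Δ : M) (g : G) : ℝ :=
  limUnder atTop (fun n : ℕ => (gsup ι Δ (g ^ n) : ℝ) / n)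

/-- `g` is inf-straight if `inf g = t_inf g`. -/
def IsInfStraight (ι : M →* G) (Δ : M) (g : G) : Prop :=
  (ginf ι Δ g : ℝ) = tInf ι Δ g

/-- `g` is sup-straight if `sup g = t_sup g`. -/
def IsSupStraight (ι : M →* G) (Δ : M) (g : G) : Prop :=
  (gsup ι Δ g : ℝ) = tSup ι Δ g

end Groups

/-! The remaining facts show that the objects above are well defined. -/

section Facts

variable {M G : Type*} [Monoid M] [Group G]

theorem exists_atoms (hM : IsAtomicMonoid M) (a : M) :
    ∃ l : List M, (∀ x ∈ l, IsAtomElt x) ∧ l.prod = a := by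
  have h : a ∈ Submonoid.closure {a : M | IsAtomElt a} := by
    rw [hM.closure_atoms]; trivial
  exact Submonoid.exists_list_of_mem_closure h

theorem eq_nil_of_fix (hM : IsAtomicMonoid M) (a : M) (l : List M)
    (hl : ∀ x ∈ l, IsAtomElt x) (h : a * l.prod = a) : l = [] := by
  obtain ⟨k, hk, hka⟩ := exists_atoms hM a
  by_contra hne
  have hpos : 1 ≤ l.length := List.length_pos_iff.2 hne
  have key : ∀ n : ℕ, ∃ m : List M, ((∀ x ∈ m, IsAtomElt x) ∧ m.prod = a) ∧ n ≤ m.length := by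
    intro n
    induction n with
    | zero => exact ⟨k, ⟨hk, hka⟩, Nat.zero_le _⟩
    | succ n ih =>
      obtain ⟨m, ⟨hm, hma⟩, hn⟩ := ih
      refine ⟨m ++ l, ⟨?_, ?_⟩, ?_⟩
      · intro x hx
        rcases List.mem_append.1 hx with hx | hx
        exacts [hm x hx, hl x hx]
      · rw [List.prod_append, hma, h]
      · rw [List.length_append]; omega
  refine (hM.atomNorm_lt_top a).ne ?_
  rw [ENat.eq_top_iff_forall_ge]
  intro n
  obtain ⟨m, hm, hn⟩ := key n
  calc (n : ℕ∞) ≤ (m.length : ℕ∞) := by exact_mod_cast hn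
    _ ≤ atomNorm a := le_iSup₂_of_le m hm le_rfl

theorem eq_one_of_mul_mul_eq (hM : IsAtomicMonoid M) {a c d : M} (h : a * (c * d) = a) :
    c = 1 ∧ d = 1 := by
  obtain ⟨k, hk, rfl⟩ := exists_atoms hM c
  obtain ⟨l, hl, rfl⟩ := exists_atoms hM d
  have := eq_nil_of_fix hM a (k ++ l) (by
    intro x hx
    rcases List.mem_append.1 hx with hx | hx
    exacts [hk x hx, hl x hx]) (by rw [List.prod_append, h])
  obtain ⟨rfl, rfl⟩ := List.append_eq_nil_iff.1 this
  simp

theorem LeL.antisymm (hM : IsAtomicMonoid M) {a b : M} (h : LeL a b) (h' : LeL b a) : a = b := by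
  obtain ⟨c, rfl⟩ := h
  obtain ⟨d, hd⟩ := h'
  rw [mul_assoc] at hd
  rw [(eq_one_of_mul_mul_eq hM hd).1, mul_one]

theorem LeR.antisymm [IsCancelMul M] (hM : IsAtomicMonoid M) {a b : M} (h : LeR a b)
    (h' : LeR b a) : a = b := by
  obtain ⟨c, rfl⟩ := h
  obtain ⟨d, hd⟩ := h'
  rw [← mul_assoc] at hd
  have h1 : d * c = 1 := mul_right_cancel (b := a) (by rw [hd, one_mul])
  have h2 : (1 : M) * (d * c) = 1 := by rw [h1, one_mul]
  rw [(eq_one_of_mul_mul_eq hM h2).2, one_mul]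

/-- `a Δ = Δ a'`. -/
theorem exists_mul_comm [IsCancelMul M] {Δ : M} (hΔ : IsGarsideElement Δ) (a : M) :
    ∃ a' : M, a * Δ = Δ * a' := by
  have h : a ∈ Submonoid.closure {a : M | LeL a Δ} := by
    rw [hΔ.closure_simples]; trivial
  induction h using Submonoid.closure_induction with
  | mem s hs =>
    obtain ⟨t, ht⟩ := hs
    obtain ⟨u, hu⟩ := (hΔ.leL_iff_leR t).2 ⟨s, ht⟩
    exact ⟨u, by rw [← ht, mul_assoc s t u, hu, ht]⟩
  | one => exact ⟨1, by simp⟩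
  | mul x y _ _ hx hy =>
    obtain ⟨x', hx⟩ := hx
    obtain ⟨y', hy⟩ := hy
    exact ⟨x' * y', by rw [mul_assoc, hy, ← mul_assoc, hx, mul_assoc]⟩

/-- `Δ a = a' Δ`. -/
theorem exists_mul_comm' [IsCancelMul M] {Δ : M} (hΔ : IsGarsideElement Δ) (a : M) :
    ∃ a' : M, Δ * a = a' * Δ := by
  have h : a ∈ Submonoid.closure {a : M | LeL a Δ} := by
    rw [hΔ.closure_simples]; trivial
  induction h using Submonoid.closure_induction with
  | mem s hs =>
    obtain ⟨t, ht⟩ := (hΔ.leL_iff_leR s).1 hs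
    obtain ⟨u, hu⟩ := (hΔ.leL_iff_leR t).1 ⟨s, ht⟩
    exact ⟨u, by rw [← ht, ← mul_assoc, hu, ht]⟩
  | one => exact ⟨1, by simp⟩
  | mul x y _ _ hx hy =>
    obtain ⟨x', hx⟩ := hx
    obtain ⟨y', hy⟩ := hy
    exact ⟨x' * y', by rw [← mul_assoc, hx, mul_assoc, hy, mul_assoc]⟩

/-- Positive elements are stable under conjugation by powers of `Δ`. -/
theorem exists_zpow_mul [IsCancelMul M] {Δ : M} (hΔ : IsGarsideElement Δ) (ι : M →* G)
    (n : ℤ) (a : M) : ∃ b : M, ι a * ι Δ ^ n = ι Δ ^ n * ι b := by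
  induction n using Int.induction_on generalizing a with
  | zero => exact ⟨a, by simp⟩
  | succ n ih =>
    obtain ⟨b, hb⟩ := ih a
    obtain ⟨c, hc⟩ := exists_mul_comm hΔ b
    have hc' : ι b * ι Δ = ι Δ * ι c := by rw [← map_mul, hc, map_mul]
    exact ⟨c, by rw [zpow_add_one, ← mul_assoc, hb, mul_assoc, hc', mul_assoc]⟩
  | pred n ih =>
    obtain ⟨b, hb⟩ := ih a
    obtain ⟨c, hc⟩ := exists_mul_comm' hΔ b
    have hc' : ι b * (ι Δ)⁻¹ = (ι Δ)⁻¹ * ι c := by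
      rw [mul_inv_eq_iff_eq_mul, mul_assoc, ← map_mul, ← hc, map_mul, inv_mul_cancel_left]
    exact ⟨c, by rw [zpow_sub_one, ← mul_assoc, hb, mul_assoc, hc', mul_assoc]⟩

theorem GLeL.mul [IsCancelMul M] {Δ : M} (hΔ : IsGarsideElement Δ) {ι : M →* G} {g h : G}
    {r s : ℤ} (hg : GLeL ι (ι Δ ^ r) g) (hh : GLeL ι (ι Δ ^ s) h) :
    GLeL ι (ι Δ ^ (r + s)) (g * h) := by
  obtain ⟨c, rfl⟩ := hg
  obtain ⟨d, rfl⟩ := hh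
  obtain ⟨c', hc⟩ := exists_zpow_mul hΔ ι s c
  refine ⟨c' * d, ?_⟩
  calc ι Δ ^ (r + s) * ι (c' * d) = ι Δ ^ r * (ι Δ ^ s * ι c') * ι d := by
        rw [zpow_add, map_mul]; group
    _ = _ := by rw [← hc]; group

theorem gLeL_inv [IsCancelMul M] {Δ : M} (hΔ : IsGarsideElement Δ) {ι : M →* G} {g : G} {s : ℤ} :
    GLeL ι g (ι Δ ^ s) ↔ GLeL ι (ι Δ ^ (-s)) g⁻¹ := by
  constructor
  · rintro ⟨c, hc⟩
    obtain ⟨d, hd⟩ := exists_zpow_mul hΔ ι (-s) c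
    refine ⟨d, ?_⟩
    rw [← hd, zpow_neg, ← hc]; group
  · rintro ⟨c, hc⟩
    obtain ⟨d, hd⟩ := exists_zpow_mul hΔ ι s c
    refine ⟨d, ?_⟩
    have : g = (ι c)⁻¹ * ι Δ ^ s := by
      rw [← inv_inv g, ← hc, zpow_neg]; group
    rw [this, mul_assoc, ← hd]; group

/-- Every positive element left divides a power of `Δ`. -/
theorem exists_mul_eq_pow [IsCancelMul M] {Δ : M} (hΔ : IsGarsideElement Δ) (a : M) :
    ∃ (n : ℕ) (c : M), a * c = Δ ^ n := by
  have h : a ∈ Submonoid.closure {a : M | LeL a Δ} := by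
    rw [hΔ.closure_simples]; trivial
  have hp : ∀ (n : ℕ) (b : M), ∃ b', b * Δ ^ n = Δ ^ n * b' := by
    intro n
    induction n with
    | zero => exact fun b => ⟨b, by simp⟩
    | succ n ih =>
      intro b
      obtain ⟨b', hb⟩ := ih b
      obtain ⟨c, hc⟩ := exists_mul_comm hΔ b'
      exact ⟨c, by rw [pow_succ, ← mul_assoc, hb, mul_assoc, hc, mul_assoc]⟩
  induction h using Submonoid.closure_induction with
  | mem s hs => obtain ⟨t, ht⟩ := hs; exact ⟨1, t, by rw [ht, pow_one]⟩
  | one => exact ⟨0, 1, by simp⟩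
  | mul x y _ _ hx hy =>
    obtain ⟨n, c, hc⟩ := hx
    obtain ⟨m, d, hd⟩ := hy
    obtain ⟨c', hc'⟩ := hp m c
    refine ⟨n + m, d * c', ?_⟩
    calc x * y * (d * c') = x * ((y * d) * c') := by simp only [mul_assoc]
      _ = x * c * Δ ^ m := by rw [hd, ← hc', mul_assoc]
      _ = _ := by rw [hc, pow_add]

variable {ι : M →* G} {Δ : M}

theorem exists_zpow_gLeL (hM : IsGarsideMonoid M) (hΔ : IsGarsideElement Δ)
    (hι : IsGroupOfFractions ι) (g : G) : ∃ r : ℤ, GLeL ι (ι Δ ^ r) g := by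
  have := hM.cancel
  obtain ⟨a, b, rfl⟩ := hι.exists_fraction g
  obtain ⟨n, c, hc⟩ := exists_mul_eq_pow hΔ b
  obtain ⟨d, hd⟩ := exists_zpow_mul hΔ ι (-n) (a * c)
  refine ⟨-n, d, ?_⟩
  have : ι Δ ^ (n : ℤ) = ι b * ι c := by rw [zpow_natCast, ← map_pow, ← hc, map_mul]
  rw [← hd, zpow_neg, this, map_mul]; group

theorem exists_gLeL_zpow (hM : IsGarsideMonoid M) (hΔ : IsGarsideElement Δ)
    (hι : IsGroupOfFractions ι) (g : G) : ∃ s : ℤ, GLeL ι g (ι Δ ^ s) := by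
  have := hM.cancel
  obtain ⟨r, hr⟩ := exists_zpow_gLeL hM hΔ hι g⁻¹
  exact ⟨-r, (gLeL_inv hΔ).2 (by rwa [neg_neg])⟩

theorem ne_one [Nontrivial M] (hM : IsGarsideMonoid M) (hΔ : IsGarsideElement Δ) : Δ ≠ 1 := by
  rintro rfl
  have hs : {a : M | LeL a 1} ⊆ {1} := by
    rintro a ⟨c, hc⟩
    exact (eq_one_of_mul_mul_eq hM.atomic (a := 1) (c := a) (d := c) (by rw [hc, one_mul])).1
  have h : (⊤ : Submonoid M) ≤ ⊥ := by
    rw [← hΔ.closure_simples, Submonoid.closure_le]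
    exact hs
  obtain ⟨x, hx⟩ := exists_ne (1 : M)
  exact hx (Submonoid.mem_bot.1 (h (Submonoid.mem_top x)))

theorem le_of_gLeL [Nontrivial M] (hM : IsGarsideMonoid M) (hΔ : IsGarsideElement Δ)
    (hι : IsGroupOfFractions ι) {g : G} {r s : ℤ} (hr : GLeL ι (ι Δ ^ r) g)
    (hs : GLeL ι g (ι Δ ^ s)) : r ≤ s := by
  by_contra! hlt
  obtain ⟨c, rfl⟩ := hr
  obtain ⟨d, hd⟩ := hs
  obtain ⟨n, hn⟩ : ∃ n : ℕ, r - s = n + 1 := ⟨(r - s - 1).toNat, by omega⟩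
  have h1 : ι (Δ * (Δ ^ n * (c * d))) = ι 1 := by
    have h2 : ι Δ ^ (r - s) * (ι c * ι d) = 1 := by
      rw [mul_assoc] at hd
      rw [sub_eq_add_neg, add_comm, zpow_add, mul_assoc, hd, zpow_neg, inv_mul_cancel]
    rw [hn, add_comm, zpow_add, zpow_one, zpow_natCast] at h2
    simpa [mul_assoc] using h2
  have h3 := hι.injective h1
  exact ne_one hM hΔ (eq_one_of_mul_mul_eq hM.atomic (a := 1) (by rw [h3, one_mul])).1

theorem isGreatest_ginf [Nontrivial M] (hM : IsGarsideMonoid M) (hΔ : IsGarsideElement Δ)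
    (hι : IsGroupOfFractions ι) (g : G) :
    IsGreatest {r : ℤ | GLeL ι (ι Δ ^ r) g} (ginf ι Δ g) := by
  obtain ⟨s, hs⟩ := exists_gLeL_zpow hM hΔ hι g
  have hb : BddAbove {r : ℤ | GLeL ι (ι Δ ^ r) g} := ⟨s, fun r hr => le_of_gLeL hM hΔ hι hr hs⟩
  exact ⟨Int.csSup_mem (exists_zpow_gLeL hM hΔ hι g) hb, fun r hr => le_csSup hb hr⟩

theorem isLeast_gsup [Nontrivial M] (hM : IsGarsideMonoid M) (hΔ : IsGarsideElement Δ)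
    (hι : IsGroupOfFractions ι) (g : G) :
    IsLeast {s : ℤ | GLeL ι g (ι Δ ^ s)} (gsup ι Δ g) := by
  obtain ⟨r, hr⟩ := exists_zpow_gLeL hM hΔ hι g
  have hb : BddBelow {s : ℤ | GLeL ι g (ι Δ ^ s)} := ⟨r, fun s hs => le_of_gLeL hM hΔ hι hr hs⟩
  exact ⟨Int.csInf_mem (exists_gLeL_zpow hM hΔ hι g) hb, fun r hr => csInf_le hb hr⟩

theorem gsup_eq_neg_ginf_inv [Nontrivial M] (hM : IsGarsideMonoid M) (hΔ : IsGarsideElement Δ)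
    (hι : IsGroupOfFractions ι) (g : G) : gsup ι Δ g = -ginf ι Δ g⁻¹ := by
  have := hM.cancel
  refine (isLeast_gsup hM hΔ hι g).unique ⟨?_, fun s hs => ?_⟩
  · exact (gLeL_inv hΔ).2 (by rw [neg_neg]; exact (isGreatest_ginf hM hΔ hι g⁻¹).1)
  · have := (isGreatest_ginf hM hΔ hι g⁻¹).2 ((gLeL_inv hΔ).1 hs)
    omega

theorem ginf_add_le [Nontrivial M] (hM : IsGarsideMonoid M) (hΔ : IsGarsideElement Δ)
    (hι : IsGroupOfFractions ι) (g h : G) : ginf ι Δ g + ginf ι Δ h ≤ ginf ι Δ (g * h) := by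
  have := hM.cancel
  exact (isGreatest_ginf hM hΔ hι _).2
    ((isGreatest_ginf hM hΔ hι g).1.mul hΔ (isGreatest_ginf hM hΔ hι h).1)

theorem ginf_one [Nontrivial M] (hM : IsGarsideMonoid M) (hΔ : IsGarsideElement Δ)
    (hι : IsGroupOfFractions ι) : ginf ι Δ 1 = 0 := by
  refine (isGreatest_ginf hM hΔ hι 1).unique ⟨⟨1, by simp⟩, fun r hr => ?_⟩
  exact le_of_gLeL hM hΔ hι hr ⟨1, by simp⟩

theorem exists_tendsto_ginf (hM : IsGarsideMonoid M) (hΔ : IsGarsideElement Δ)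
    (hι : IsGroupOfFractions ι) (g : G) :
    ∃ t : ℝ, Tendsto (fun n : ℕ => (ginf ι Δ (g ^ n) : ℝ) / n) atTop (𝓝 t) := by
  rcases subsingleton_or_nontrivial M with hs | hs
  · have hG : ∀ x : G, x = 1 := fun x => by
      obtain ⟨a, b, rfl⟩ := hι.exists_fraction x
      rw [Subsingleton.elim a b, mul_inv_cancel]
    have h0 : ∀ x : G, ginf ι Δ x = 0 := fun x => by
      have : {r : ℤ | GLeL ι (ι Δ ^ r) x} = Set.univ :=
        Set.eq_univ_of_forall fun r => ⟨1, by rw [hG x, hG (_ * _)]⟩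
      rw [ginf, this]
      exact (csSup_of_not_bddAbove not_bddAbove_univ).trans Int.csSup_empty
    exact ⟨0, by simp [h0]⟩
  · have hsub : Subadditive (fun n : ℕ => -(ginf ι Δ (g ^ n) : ℝ)) := by
      intro m n
      have := ginf_add_le hM hΔ hι (g ^ m) (g ^ n)
      rw [← pow_add] at this
      have h' : (ginf ι Δ (g ^ m) : ℝ) + ginf ι Δ (g ^ n) ≤ ginf ι Δ (g ^ (m + n)) := by
        exact_mod_cast this
      linarith
    have hinv : ∀ n : ℕ, (n : ℤ) * ginf ι Δ g⁻¹ ≤ ginf ι Δ (g⁻¹ ^ n) := by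
      intro n
      induction n with
      | zero => simp [ginf_one hM hΔ hι]
      | succ n ih =>
        have := ginf_add_le hM hΔ hι (g⁻¹ ^ n) g⁻¹
        rw [← pow_succ] at this
        push_cast
        linarith
    have hup : ∀ n : ℕ, ginf ι Δ (g ^ n) ≤ -((n : ℤ) * ginf ι Δ g⁻¹) := by
      intro n
      have := ginf_add_le hM hΔ hι (g ^ n) (g⁻¹ ^ n)
      rw [inv_pow, mul_inv_cancel, ginf_one hM hΔ hι, ← inv_pow] at this
      linarith [hinv n]
    have hbdd : BddBelow (Set.range fun n : ℕ => -(ginf ι Δ (g ^ n) : ℝ) / n) := by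
      refine ⟨min 0 (ginf ι Δ g⁻¹ : ℝ), ?_⟩
      rintro _ ⟨n, rfl⟩
      rcases Nat.eq_zero_or_pos n with rfl | hn
      · simp
      · refine (min_le_right _ _).trans ?_
        have hn' : (0 : ℝ) < n := by exact_mod_cast hn
        have h' : (ginf ι Δ (g ^ n) : ℝ) ≤ -((n : ℝ) * ginf ι Δ g⁻¹) := by exact_mod_cast hup n
        simp only
        rw [le_div_iff₀ hn']
        linarith
    refine ⟨-hsub.lim, ?_⟩
    have := (hsub.tendsto_lim hbdd).neg
    simpa [neg_div] using this

theorem tendsto_tInf (hM : IsGarsideMonoid M) (hΔ : IsGarsideElement Δ)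
    (hι : IsGroupOfFractions ι) (g : G) :
    Tendsto (fun n : ℕ => (ginf ι Δ (g ^ n) : ℝ) / n) atTop (𝓝 (tInf ι Δ g)) :=
  tendsto_nhds_limUnder (exists_tendsto_ginf hM hΔ hι g)

theorem tendsto_tSup (hM : IsGarsideMonoid M) (hΔ : IsGarsideElement Δ)
    (hι : IsGroupOfFractions ι) (g : G) :
    Tendsto (fun n : ℕ => (gsup ι Δ (g ^ n) : ℝ) / n) atTop (𝓝 (tSup ι Δ g)) := by
  refine tendsto_nhds_limUnder ?_
  rcases subsingleton_or_nontrivial M with hs | hs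
  · have hG : ∀ x : G, x = 1 := fun x => by
      obtain ⟨a, b, rfl⟩ := hι.exists_fraction x
      rw [Subsingleton.elim a b, mul_inv_cancel]
    have h0 : ∀ x : G, gsup ι Δ x = 0 := fun x => by
      have : {s : ℤ | GLeL ι x (ι Δ ^ s)} = Set.univ :=
        Set.eq_univ_of_forall fun r => ⟨1, by rw [hG (_ ^ _), hG (_ * _)]⟩
      rw [gsup, this]
      exact (csInf_of_not_bddBelow not_bddBelow_univ).trans Int.csInf_empty
    exact ⟨0, by simp [h0]⟩
  · obtain ⟨t, ht⟩ := exists_tendsto_ginf hM hΔ hι g⁻¹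
    refine ⟨-t, ?_⟩
    have := ht.neg
    simpa [gsup_eq_neg_ginf_inv hM hΔ hι, neg_div] using this

end Facts

end Garside

/-! The substance is that an integer `r ≤ t_inf(g)` satisfies `r ≤ inf(h)` for some conjugate `h` of
`g` (`exists_isConj_le_ginf`). For `r = t_inf(g)` such an `h` is inf-straight, because `inf(h) ≤
t_inf(h) = t_inf(g)`; the converse only needs that `t_inf` is a conjugacy invariant. Inversion
exchanges `inf` with `-sup`, which yields (ii).

Left divisibility makes `G` a lattice whose order is preserved by all left translations and by right
multiplication by powers of `Δ`, and whose intervals `[Δ^a, Δ^b]` are finite. Let `y_N` be the meet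
of the `g^j Δ^(-rj)`, `j ≤ N` (`orbitInf`). Conjugation by `y_N ⊔ Δ⁻¹` keeps `g` in its interval
(`conj_mem_Icc`), and `y_N ⊔ Δ⁻¹` is stationary from an index `T` common to the whole interval
(`exists_orbitInf_sup_eq`). If no conjugate of `g` lies above `Δ^r`, then every block of `T` steps
costs a power of `Δ`: `y_(kT)` is never above `Δ^(1-k)` (`not_le_orbitInf_mul`). But `r ≤ t_inf(g)`
lets `inf(g^j) - rj` fall only sublinearly, which is a contradiction for a suitable `k`. -/

namespace Garside

/-! ### Meets along an orbit in a left-invariant lattice order -/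

section LatticeOrderedGroup

variable {G : Type*} [Group G] [Lattice G]

/-- The meet of the elements `g ^ j * δ ^ (-r j)` for `0 ≤ j ≤ N`. -/
def orbitInf (δ : G) (r : ℤ) (g : G) : ℕ → G
  | 0 => 1
  | N + 1 => orbitInf δ r g N ⊓ g ^ (N + 1) * δ ^ (-r * ((N + 1 : ℕ) : ℤ))

theorem le_orbitInf_iff {δ : G} {r : ℤ} {g x : G} {N : ℕ} :
    x ≤ orbitInf δ r g N ↔ ∀ j : ℕ, j ≤ N → x ≤ g ^ j * δ ^ (-r * (j : ℤ)) := by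
  induction N with
  | zero => simp [orbitInf]
  | succ N ih =>
    rw [orbitInf, le_inf_iff, ih]
    constructor
    · rintro ⟨h, h'⟩ j hj
      rcases Nat.le_succ_iff.1 hj with hj | rfl
      exacts [h j hj, h']
    · exact fun h => ⟨fun j hj => h j (by omega), h _ le_rfl⟩

theorem orbitInf_le {δ : G} {r : ℤ} {g : G} {N j : ℕ} (hj : j ≤ N) :
    orbitInf δ r g N ≤ g ^ j * δ ^ (-r * (j : ℤ)) :=
  le_orbitInf_iff.1 le_rfl j hj

theorem orbitInf_antitone (δ : G) (r : ℤ) (g : G) : Antitone (orbitInf δ r g) :=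
  fun _ _ h => le_orbitInf_iff.2 fun _ hj => orbitInf_le (hj.trans h)

theorem orbitInf_le_one (δ : G) (r : ℤ) (g : G) (N : ℕ) : orbitInf δ r g N ≤ 1 := by
  simpa using orbitInf_le (δ := δ) (r := r) (g := g) (Nat.zero_le N)

variable {δ : G} (hδ : ∀ x y : G, x ≤ y → ∀ n : ℤ, x * δ ^ n ≤ y * δ ^ n)
include hδ

theorem mul_zpow_le_iff {x y : G} {n : ℤ} : x * δ ^ n ≤ y ↔ x ≤ y * δ ^ (-n) := by
  constructor
  · intro h; simpa [mul_assoc] using hδ _ _ h (-n)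
  · intro h; simpa [mul_assoc] using hδ _ _ h n

variable [MulLeftMono G]

theorem le_inv_of_le_zpow {x : G} {c : ℤ} (h : x ≤ δ ^ c) : δ ^ (-c) ≤ x⁻¹ := by
  have := hδ _ _ (mul_le_mul_right h x⁻¹) (-c)
  simpa [mul_assoc] using this

/-- The inequality `h * x ≤ x * δ ^ c` holds for each `x = g ^ j * δ ^ (-r * j)`, since `h` moves
past `g ^ j`, and for `x = δ ^ e`; it survives meets and joins. Allowing any `h` that commutes with
`g` covers both `g` and `g⁻¹`, hence both ends of the interval in `conj_mem_Icc`. -/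
theorem conj_le_of_commute {r c e : ℤ} {g h : G} (hgh : Commute g h) (hh : h ≤ δ ^ c) (N : ℕ) :
    (orbitInf δ r g N ⊔ δ ^ e)⁻¹ * h * (orbitInf δ r g N ⊔ δ ^ e) ≤ δ ^ c := by
  set y := orbitInf δ r g N with hy
  have h1 : h * y ≤ y * δ ^ c := by
    have : h * y * δ ^ (-c) ≤ y := by
      rw [hy, le_orbitInf_iff]
      intro j hj
      rw [mul_zpow_le_iff hδ, neg_neg]
      calc h * orbitInf δ r g N ≤ h * (g ^ j * δ ^ (-r * (j : ℤ))) :=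
            mul_le_mul_right (orbitInf_le hj) h
        _ = g ^ j * (h * δ ^ (-r * (j : ℤ))) := by
            rw [← mul_assoc, ← (hgh.pow_left j).eq, mul_assoc]
        _ ≤ g ^ j * (δ ^ c * δ ^ (-r * (j : ℤ))) := mul_le_mul_right (hδ _ _ hh _) _
        _ = _ := by rw [mul_assoc, ← zpow_add, ← zpow_add, add_comm]
    rwa [mul_zpow_le_iff hδ, neg_neg] at this
  have h2 : h * (y ⊔ δ ^ e) ≤ (y ⊔ δ ^ e) * δ ^ c := by
    rw [mul_sup]
    refine sup_le (h1.trans (hδ _ _ le_sup_left c)) ?_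
    calc h * δ ^ e ≤ δ ^ c * δ ^ e := hδ _ _ hh e
      _ = δ ^ e * δ ^ c := by rw [← zpow_add, add_comm, zpow_add]
      _ ≤ _ := hδ _ _ le_sup_right c
  have := mul_le_mul_right h2 (y ⊔ δ ^ e)⁻¹
  simpa [mul_assoc] using this

theorem conj_mem_Icc {r a b e : ℤ} {g : G} (hg : g ∈ Set.Icc (δ ^ a) (δ ^ b)) (N : ℕ) :
    (orbitInf δ r g N ⊔ δ ^ e)⁻¹ * g * (orbitInf δ r g N ⊔ δ ^ e)
      ∈ Set.Icc (δ ^ a) (δ ^ b) := by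
  refine ⟨?_, conj_le_of_commute hδ (Commute.refl g) hg.2 N⟩
  have h : g⁻¹ ≤ δ ^ (-a) := by
    have := hδ _ _ (mul_le_mul_right hg.1 g⁻¹) (-a)
    simpa [mul_assoc] using this
  have := le_inv_of_le_zpow hδ
    (conj_le_of_commute (r := r) (e := e) hδ (Commute.refl g).inv_right h N)
  rw [neg_neg] at this
  simpa [mul_assoc] using this

/-- The terms of the long meet with indices `j, …, j + T` are `g ^ j` times the terms of the short
one, up to a power of `δ` on the right. So each window of length `T` bounds the long meet by `g ^ j
* u * δ ^ (-r * j)`, which is `u` times the `j`-th term for the conjugate `u⁻¹ * g * u`. -/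
theorem orbitInf_add_le {r : ℤ} {g u : G} {T N : ℕ} (hu : orbitInf δ r g T ≤ u) :
    orbitInf δ r g (T + N) ≤ u * orbitInf δ r (u⁻¹ * g * u) N := by
  suffices h : u⁻¹ * orbitInf δ r g (T + N) ≤ orbitInf δ r (u⁻¹ * g * u) N by
    have := mul_le_mul_right h u
    simpa using this
  rw [le_orbitInf_iff]
  intro j hj
  have h1 : (g ^ j)⁻¹ * orbitInf δ r g (T + N) * δ ^ (r * (j : ℤ)) ≤ orbitInf δ r g T := by
    rw [le_orbitInf_iff]
    intro i hi
    have := hδ _ _ (mul_le_mul_right (orbitInf_le (δ := δ) (r := r) (g := g)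
      (show j + i ≤ T + N by omega)) (g ^ j)⁻¹) (r * j)
    refine this.trans_eq ?_
    rw [pow_add, mul_assoc, mul_assoc, mul_assoc, inv_mul_cancel_left, ← zpow_add]
    congr 2
    push_cast
    ring
  have h2 := (mul_zpow_le_iff hδ).1 (h1.trans hu)
  have h3 := mul_le_mul_right (mul_le_mul_right h2 (g ^ j)) u⁻¹
  rw [mul_inv_cancel_left] at h3
  refine h3.trans_eq ?_
  have h4 : (u⁻¹ * g * u) ^ j = u⁻¹ * g ^ j * u := by
    simpa using (conj_pow (i := j) (a := u⁻¹) (b := g))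
  rw [h4, neg_mul]
  simp only [mul_assoc]

/-- Induction on `k`, replacing `g` by a conjugate at each step; this is why `T` must serve the
whole interval and why `hr` speaks of all conjugates. -/
theorem not_le_orbitInf_mul {r a b : ℤ} {g : G} (h1 : (1 : G) ≤ δ) (hne : ¬ δ ≤ 1) {T : ℕ}
    (hT : ∀ h ∈ Set.Icc (δ ^ a) (δ ^ b), ∀ N, T ≤ N →
      orbitInf δ r h N ⊔ δ ^ (-1 : ℤ) = orbitInf δ r h T ⊔ δ ^ (-1 : ℤ))
    (hT0 : 1 ≤ T) (hr : ∀ u : G, ¬ δ ^ r ≤ u⁻¹ * g * u) (k : ℕ) :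
    g ∈ Set.Icc (δ ^ a) (δ ^ b) → ¬ δ ^ (1 - (k : ℤ)) ≤ orbitInf δ r g (k * T) := by
  induction k generalizing g with
  | zero => intro _; simpa [orbitInf] using hne
  | succ k ih =>
    intro hg hle
    set z := orbitInf δ r g ((k + 1) * T) with hz
    -- The case `k = 0` is where `hr` enters: `1 ≤ z` gives `δ ^ r ≤ g` through the term `j = 1`,
    -- available as `T ≥ 1`. The general step needs `z * δ ^ (1 - k) ≤ z`, hence `k ≥ 1`.
    rcases Nat.eq_zero_or_pos k with rfl | hk
    · have h2 : (1 : G) ≤ g * δ ^ (-r) := by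
        have := hle.trans (orbitInf_le (j := 1) (by omega))
        simpa using this
      rw [← mul_zpow_le_iff hδ, one_mul] at h2
      exact hr 1 (by simpa using h2)
    set u := orbitInf δ r g T ⊔ δ ^ (-1 : ℤ) with hu
    have hzu : z ⊔ δ ^ (-1 : ℤ) = u := hT g hg _ (Nat.le_mul_of_pos_left _ (Nat.succ_pos k))
    have hpow : ∀ n : ℕ, z * δ ^ (-(n : ℤ)) ≤ z := by
      intro n
      rw [mul_zpow_le_iff hδ, neg_neg, zpow_natCast]
      have hn : (1 : G) ≤ δ ^ n := by
        induction n with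
        | zero => simp
        | succ n ih =>
          rw [pow_succ]
          exact ih.trans (by simpa using mul_le_mul_right h1 (δ ^ n))
      simpa using mul_le_mul_right hn z
    -- As `u = z ⊔ δ⁻¹`, the bound is checked on both joinands; on `δ⁻¹` it is the assumption `δ ^
    -- (-k) ≤ z`. Combined with `h3`, cancelling `u` leaves the same assumption for the conjugate
    -- with `k` lowered by one.
    have h2 : u * δ ^ (1 - (k : ℤ)) ≤ z := by
      rw [mul_zpow_le_iff hδ, ← hzu]
      refine sup_le ?_ ?_
      · have := hpow (k - 1)
        rw [mul_zpow_le_iff hδ] at this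
        convert this using 3
        push_cast [Nat.cast_sub hk]
        ring
      · rw [← mul_zpow_le_iff hδ, ← zpow_add]
        convert hle using 2
        push_cast
        ring
    have h3 : z ≤ u * orbitInf δ r (u⁻¹ * g * u) (k * T) := by
      rw [hz, show (k + 1) * T = T + k * T by ring]
      exact orbitInf_add_le hδ le_sup_left
    refine ih (g := u⁻¹ * g * u) ?_ (conj_mem_Icc hδ hg T) ?_
    · intro v hv
      refine hr (u * v) (hv.trans_eq ?_)
      group
    · have := mul_le_mul_right (h2.trans h3) u⁻¹
      simpa using this

theorem exists_orbitInf_sup_eq (hfin : ∀ a b : ℤ, (Set.Icc (δ ^ a) (δ ^ b)).Finite)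
    (h1 : (1 : G) ≤ δ) (r a b : ℤ) :
    ∃ T : ℕ, 1 ≤ T ∧ ∀ h ∈ Set.Icc (δ ^ a) (δ ^ b), ∀ N, T ≤ N →
      orbitInf δ r h N ⊔ δ ^ (-1 : ℤ) = orbitInf δ r h T ⊔ δ ^ (-1 : ℤ) := by
  have hinv : δ ^ (-1 : ℤ) ≤ 1 := by
    have := hδ _ _ h1 (-1)
    simpa using this
  have key : ∀ h : G, ∃ T : ℕ, ∀ N, T ≤ N →
      orbitInf δ r h N ⊔ δ ^ (-1 : ℤ) = orbitInf δ r h T ⊔ δ ^ (-1 : ℤ) := by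
    intro h
    let f : ℕ → G := fun N => orbitInf δ r h N ⊔ δ ^ (-1 : ℤ)
    have hf : Antitone f := fun i j hij => sup_le_sup_right (orbitInf_antitone δ r h hij) _
    have hran : (Set.range f).Finite := by
      refine (hfin (-1) 0).subset ?_
      rintro _ ⟨N, rfl⟩
      exact ⟨le_sup_right, by rw [zpow_zero]; exact sup_le (orbitInf_le_one δ r h N) hinv⟩
    -- A decreasing sequence in the finite interval `[δ⁻¹, 1]` is constant once it attains a minimal
    -- value.
    obtain ⟨_, ⟨T, rfl⟩, hmin⟩ := hran.exists_minimal (Set.range_nonempty f)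
    exact ⟨T, fun N hN => le_antisymm (hf hN) (hmin ⟨N, rfl⟩ (hf hN))⟩
  choose τ hτ using key
  -- The largest stabilisation index over the finite interval; the `+ 1` only secures `1 ≤ T`.
  refine ⟨(hfin a b).toFinset.sup τ + 1, by omega, fun h hh N hN => ?_⟩
  have hle : τ h ≤ (hfin a b).toFinset.sup τ := Finset.le_sup ((hfin a b).mem_toFinset.2 hh)
  rw [hτ h N (by omega), hτ h (_ + 1) (by omega)]

theorem exists_conj_zpow_le (hfin : ∀ a b : ℤ, (Set.Icc (δ ^ a) (δ ^ b)).Finite)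
    (h1 : (1 : G) ≤ δ) (hne : ¬ δ ≤ 1) {r a b : ℤ} {g : G}
    (hg : g ∈ Set.Icc (δ ^ a) (δ ^ b))
    (hgrow : ∀ T : ℕ, ∃ k : ℕ, ∀ j ≤ k * T, δ ^ (r * (j : ℤ) + 1 - (k : ℤ)) ≤ g ^ j) :
    ∃ u : G, δ ^ r ≤ u⁻¹ * g * u := by
  by_contra! hr
  obtain ⟨T, hT0, hT⟩ := exists_orbitInf_sup_eq hδ hfin h1 r a b
  obtain ⟨k, hk⟩ := hgrow T
  refine not_le_orbitInf_mul hδ h1 hne hT hT0 hr k hg (le_orbitInf_iff.2 fun j hj => ?_)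
  rw [neg_mul, ← mul_zpow_le_iff hδ, ← zpow_add]
  convert hk j hj using 2
  ring

end LatticeOrderedGroup

/-! ### The lattice order on the group of fractions and its finite intervals -/

section Lattice

variable {M G : Type*} [Monoid M] [Group G] {ι : M →* G} {Δ : M}

theorem GLeL.trans {g h k : G} (h₁ : GLeL ι g h) (h₂ : GLeL ι h k) : GLeL ι g k := by
  obtain ⟨c, rfl⟩ := h₁
  obtain ⟨d, rfl⟩ := h₂
  exact ⟨c * d, by rw [map_mul, mul_assoc]⟩

theorem GLeL.mul_left {g h : G} (hgh : GLeL ι g h) (k : G) : GLeL ι (k * g) (k * h) := by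
  obtain ⟨c, rfl⟩ := hgh
  exact ⟨c, mul_assoc _ _ _⟩

theorem GLeL.mul_zpow [IsCancelMul M] (hΔ : IsGarsideElement Δ) {g h : G} (hgh : GLeL ι g h)
    (n : ℤ) : GLeL ι (g * ι Δ ^ n) (h * ι Δ ^ n) := by
  obtain ⟨c, rfl⟩ := hgh
  obtain ⟨d, hd⟩ := exists_zpow_mul hΔ ι n c
  exact ⟨d, by rw [mul_assoc, mul_assoc, hd]⟩

theorem GLeL.antisymm (hM : IsGarsideMonoid M) (hι : IsGroupOfFractions ι) {g h : G}
    (hgh : GLeL ι g h) (hhg : GLeL ι h g) : g = h := by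
  obtain ⟨c, rfl⟩ := hgh
  obtain ⟨d, hd⟩ := hhg
  rw [mul_assoc, mul_eq_left, ← map_mul, ← map_one ι] at hd
  have := eq_one_of_mul_mul_eq hM.atomic (a := 1) (c := c) (d := d)
    (by rw [hι.injective hd, one_mul])
  rw [this.1, map_one, mul_one]

theorem gLeL_map_iff (hι : IsGroupOfFractions ι) {a b : M} : GLeL ι (ι a) (ι b) ↔ LeL a b := by
  constructor
  · rintro ⟨c, hc⟩
    exact ⟨c, hι.injective (by rw [map_mul, hc])⟩
  · rintro ⟨c, rfl⟩
    exact ⟨c, (map_mul _ _ _).symm⟩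

theorem gLeL_mul_left_iff {g h k : G} : GLeL ι (k * g) (k * h) ↔ GLeL ι g h :=
  ⟨fun H => by simpa using H.mul_left k⁻¹, fun H => H.mul_left k⟩

theorem zpow_gLeL_zpow {r s : ℤ} (h : r ≤ s) : GLeL ι (ι Δ ^ r) (ι Δ ^ s) := by
  obtain ⟨n, rfl⟩ := Int.le.dest h
  exact ⟨Δ ^ n, by rw [map_pow, zpow_add, zpow_natCast]⟩

theorem exists_zpow_gLeL_pair (hM : IsGarsideMonoid M) (hΔ : IsGarsideElement Δ)
    (hι : IsGroupOfFractions ι) (g h : G) :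
    ∃ (r : ℤ) (a b : M), g = ι Δ ^ r * ι a ∧ h = ι Δ ^ r * ι b := by
  obtain ⟨r, hr⟩ := exists_zpow_gLeL hM hΔ hι g
  obtain ⟨s, hs⟩ := exists_zpow_gLeL hM hΔ hι h
  obtain ⟨a, ha⟩ := (zpow_gLeL_zpow (min_le_left r s)).trans hr
  obtain ⟨b, hb⟩ := (zpow_gLeL_zpow (min_le_right r s)).trans hs
  exact ⟨min r s, a, b, ha.symm, hb.symm⟩

/-- Left multiplication preserves the meets of a Garside monoid. -/
theorem leL_mul_left_of_isMeet (hM : IsGarsideMonoid M) {a b m x : M}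
    (hm : ∀ c, LeL c a → LeL c b → LeL c m) {c : M} (hca : LeL c (x * a))
    (hcb : LeL c (x * b)) : LeL c (x * m) := by
  have := hM.cancel
  obtain ⟨⟨n, hna, hnb, hn⟩, -⟩ := hM.meets_joins_L (x * a) (x * b)
  -- The meet of `x * a` and `x * b` is a right multiple `x * p` of their common left divisor `x`;
  -- cancelling `x` compares `p` with `m`.
  obtain ⟨p, rfl⟩ := hn x ⟨a, rfl⟩ ⟨b, rfl⟩
  have cancel : ∀ y, LeL (x * p) (x * y) → LeL p y := by
    rintro y ⟨d, hd⟩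
    exact ⟨d, mul_left_cancel ((mul_assoc x p d).symm.trans hd)⟩
  obtain ⟨d, hd⟩ := hm p (cancel a hna) (cancel b hnb)
  obtain ⟨e, he⟩ := hn c hca hcb
  exact ⟨e * d, by rw [← mul_assoc, he, mul_assoc, hd]⟩

/-- A left translation by a power of `Δ` moves both elements into `M`. Upper bounds then lie in the
translated copy of `M` automatically; a lower bound may require a smaller power of `Δ`, whence
`leL_mul_left_of_isMeet`. -/
theorem hasMeetsJoins_gLeL (hM : IsGarsideMonoid M) (hΔ : IsGarsideElement Δ)
    (hι : IsGroupOfFractions ι) : HasMeetsJoins (GLeL ι) := by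
  intro g h
  obtain ⟨r, a, b, rfl, rfl⟩ := exists_zpow_gLeL_pair hM hΔ hι g h
  obtain ⟨⟨m, hma, hmb, hm⟩, j, haj, hbj, hj⟩ := hM.meets_joins_L a b
  have map_le : ∀ {x y : M}, LeL x y → GLeL ι (ι Δ ^ r * ι x) (ι Δ ^ r * ι y) :=
    fun hxy => ((gLeL_map_iff hι).2 hxy).mul_left _
  refine ⟨⟨ι Δ ^ r * ι m, map_le hma, map_le hmb, fun c hca hcb => ?_⟩,
    ⟨ι Δ ^ r * ι j, map_le haj, map_le hbj, fun c hac hbc => ?_⟩⟩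
  · obtain ⟨s, hs⟩ := exists_zpow_gLeL hM hΔ hι c
    obtain ⟨d, hd⟩ := (zpow_gLeL_zpow (min_le_left s r)).trans hs
    obtain ⟨n, hn⟩ := Int.le.dest (min_le_right s r)
    have hr : ∀ x : M, ι Δ ^ r * ι x = ι Δ ^ (min s r) * ι (Δ ^ n * x) := fun x => by
      conv_lhs => rw [← hn]
      rw [zpow_add, zpow_natCast, map_mul, map_pow, mul_assoc]
    rw [← hd, hr, gLeL_mul_left_iff, gLeL_map_iff hι] at hca hcb ⊢
    exact leL_mul_left_of_isMeet hM hm hca hcb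
  · obtain ⟨d, hd⟩ : GLeL ι (ι Δ ^ r) c := GLeL.trans ⟨a, rfl⟩ hac
    rw [← hd, gLeL_mul_left_iff, gLeL_map_iff hι] at hac hbc ⊢
    exact hj d hac hbc

/-- The group of fractions of a Garside monoid, ordered by left divisibility, is a lattice. -/
noncomputable abbrev leftLattice (hM : IsGarsideMonoid M) (hΔ : IsGarsideElement Δ)
    (hι : IsGroupOfFractions ι) : Lattice G where
  le := GLeL ι
  le_refl g := ⟨1, by simp⟩
  le_trans _ _ _ := GLeL.trans
  le_antisymm _ _ := GLeL.antisymm hM hι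
  inf g h := (hasMeetsJoins_gLeL hM hΔ hι g h).1.choose
  inf_le_left g h := (hasMeetsJoins_gLeL hM hΔ hι g h).1.choose_spec.1
  inf_le_right g h := (hasMeetsJoins_gLeL hM hΔ hι g h).1.choose_spec.2.1
  le_inf c g h := (hasMeetsJoins_gLeL hM hΔ hι g h).1.choose_spec.2.2 c
  sup g h := (hasMeetsJoins_gLeL hM hΔ hι g h).2.choose
  le_sup_left g h := (hasMeetsJoins_gLeL hM hΔ hι g h).2.choose_spec.1
  le_sup_right g h := (hasMeetsJoins_gLeL hM hΔ hι g h).2.choose_spec.2.1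
  sup_le g h c := (hasMeetsJoins_gLeL hM hΔ hι g h).2.choose_spec.2.2 c

/-- Every generating set contains all atoms, because an atom written as a product equals one of the
factors. -/
theorem finite_atoms (hM : IsGarsideMonoid M) : {a : M | IsAtomElt a}.Finite := by
  obtain ⟨S, hS⟩ := (Monoid.fg_def.1 hM.fg)
  refine S.finite_toSet.subset fun a ha => ?_
  have hmem : a ∈ Submonoid.closure (S : Set M) := by rw [hS]; trivial
  obtain ⟨l, hl, rfl⟩ := Submonoid.exists_list_of_mem_closure hmem
  clear hmem
  induction l with
  | nil => exact (ha.1 rfl).elim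
  | cons x l ih =>
    rw [List.prod_cons] at ha ⊢
    rcases ha.2 x l.prod rfl with h | h
    · rw [h, one_mul] at ha ⊢
      exact ih (fun y hy => hl y (List.mem_cons_of_mem _ hy)) ha
    · rw [h, mul_one]
      exact hl x List.mem_cons_self

/-- A left divisor of `b` is a word in the finitely many atoms, of length at most `‖b‖`. -/
theorem finite_leL (hM : IsGarsideMonoid M) (b : M) : {a : M | LeL a b}.Finite := by
  obtain ⟨n, hn⟩ := ENat.ne_top_iff_exists.1 (hM.atomic.atomNorm_lt_top b).ne
  have : Finite {a : M // IsAtomElt a} := finite_atoms hM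
  refine ((List.finite_length_le {a : M // IsAtomElt a} n).image
    fun l => (l.map Subtype.val).prod).subset ?_
  rintro a ⟨c, rfl⟩
  obtain ⟨l, hl, rfl⟩ := exists_atoms hM.atomic a
  obtain ⟨k, hk, rfl⟩ := exists_atoms hM.atomic c
  refine ⟨l.attachWith _ hl, ?_, by simp⟩
  have hle : ((l ++ k).length : ℕ∞) ≤ atomNorm (l.prod * k.prod) :=
    le_iSup₂_of_le (l ++ k) ⟨fun x hx => (List.mem_append.1 hx).elim (hl x) (hk x),
      List.prod_append⟩ le_rfl
  rw [← hn, Nat.cast_le, List.length_append] at hle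
  simp only [Set.mem_ofPred_eq, List.length_attachWith]
  omega

theorem finite_gLeL_zpow (hM : IsGarsideMonoid M) (hι : IsGroupOfFractions ι) (r s : ℤ) :
    {g : G | GLeL ι (ι Δ ^ r) g ∧ GLeL ι g (ι Δ ^ s)}.Finite := by
  rcases Set.eq_empty_or_nonempty {g : G | GLeL ι (ι Δ ^ r) g ∧ GLeL ι g (ι Δ ^ s)} with h | h
  · rw [h]; exact Set.finite_empty
  obtain ⟨x, hx₁, hx₂⟩ := h
  obtain ⟨b, hb⟩ := hx₁.trans hx₂
  refine ((finite_leL hM b).image fun a => ι Δ ^ r * ι a).subset ?_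
  rintro _ ⟨⟨a, rfl⟩, h⟩
  rw [← hb, gLeL_mul_left_iff, gLeL_map_iff hι] at h
  exact ⟨a, h, rfl⟩

end Lattice

/-! ### Translation numbers and straight conjugates -/

section TranslationNumbers

variable {M G : Type*} [Monoid M] [Group G] {ι : M →* G} {Δ : M}

theorem zpow_gLeL_of_le_ginf [Nontrivial M] (hM : IsGarsideMonoid M) (hΔ : IsGarsideElement Δ)
    (hι : IsGroupOfFractions ι) {g : G} {r : ℤ} (h : r ≤ ginf ι Δ g) : GLeL ι (ι Δ ^ r) g :=
  (zpow_gLeL_zpow h).trans (isGreatest_ginf hM hΔ hι g).1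

theorem mul_ginf_le [Nontrivial M] (hM : IsGarsideMonoid M) (hΔ : IsGarsideElement Δ)
    (hι : IsGroupOfFractions ι) (g : G) (n : ℕ) : (n : ℤ) * ginf ι Δ g ≤ ginf ι Δ (g ^ n) := by
  induction n with
  | zero => simp [ginf_one hM hΔ hι]
  | succ n ih =>
    have := ginf_add_le hM hΔ hι (g ^ n) g
    rw [← pow_succ] at this
    push_cast
    linarith

theorem ginf_le_tInf [Nontrivial M] (hM : IsGarsideMonoid M) (hΔ : IsGarsideElement Δ)
    (hι : IsGroupOfFractions ι) (g : G) : (ginf ι Δ g : ℝ) ≤ tInf ι Δ g := by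
  refine ge_of_tendsto (tendsto_tInf hM hΔ hι g) ?_
  filter_upwards [eventually_gt_atTop 0] with n hn
  rw [le_div_iff₀ (by exact_mod_cast hn), mul_comm]
  exact_mod_cast mul_ginf_le hM hΔ hι g n

/-- By superadditivity, conjugation by `u` lowers `inf (g ^ n)` by at most a constant independent of
`n`, which vanishes after division by `n`. -/
theorem tInf_le_tInf_conj [Nontrivial M] (hM : IsGarsideMonoid M) (hΔ : IsGarsideElement Δ)
    (hι : IsGroupOfFractions ι) (g u : G) : tInf ι Δ g ≤ tInf ι Δ (u * g * u⁻¹) := by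
  have hC : Tendsto (fun n : ℕ => ((ginf ι Δ u + ginf ι Δ u⁻¹ : ℤ) : ℝ) / n) atTop (𝓝 0) :=
    tendsto_const_div_atTop_nhds_zero_nat _
  have h := (tendsto_tInf hM hΔ hι g).add hC
  rw [add_zero] at h
  refine le_of_tendsto_of_tendsto' h (tendsto_tInf hM hΔ hι _) fun n => ?_
  rw [← add_div, conj_pow]
  have h₁ := ginf_add_le hM hΔ hι u (g ^ n)
  have h₂ := ginf_add_le hM hΔ hι (u * g ^ n) u⁻¹
  gcongr
  exact_mod_cast (by linarith :
    ginf ι Δ (g ^ n) + (ginf ι Δ u + ginf ι Δ u⁻¹) ≤ ginf ι Δ (u * g ^ n * u⁻¹))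

theorem tInf_eq_of_isConj [Nontrivial M] (hM : IsGarsideMonoid M) (hΔ : IsGarsideElement Δ)
    (hι : IsGroupOfFractions ι) {g h : G} (hgh : IsConj g h) : tInf ι Δ g = tInf ι Δ h := by
  obtain ⟨u, rfl⟩ := isConj_iff.1 hgh
  refine (tInf_le_tInf_conj hM hΔ hι g u).antisymm ?_
  simpa [mul_assoc] using tInf_le_tInf_conj hM hΔ hι (u * g * u⁻¹) u⁻¹

/-- If `r ≤ t_inf g`, then `inf (g ^ j) - r j` decreases sublinearly. -/
theorem exists_forall_le_ginf_pow [Nontrivial M] (hM : IsGarsideMonoid M)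
    (hΔ : IsGarsideElement Δ) (hι : IsGroupOfFractions ι) {g : G} {r : ℤ}
    (hr : (r : ℝ) ≤ tInf ι Δ g) (T : ℕ) :
    ∃ k : ℕ, ∀ j ≤ k * T, r * (j : ℤ) + 1 - (k : ℤ) ≤ ginf ι Δ (g ^ j) := by
  have hε : (0 : ℝ) < 1 / (2 * (T + 1)) := by positivity
  obtain ⟨N, hN⟩ := eventually_atTop.1 ((tendsto_tInf hM hΔ hι g).eventually
    (lt_mem_nhds (show tInf ι Δ g - 1 / (2 * (T + 1)) < tInf ι Δ g by linarith)))
  obtain ⟨B, hB⟩ := (Set.finite_range fun j : Fin (N + 1) =>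
    r * ((j : ℕ) : ℤ) - ginf ι Δ (g ^ (j : ℕ))).bddAbove
  -- With `k ≥ B + 1` the finitely many `j ≤ N` are covered; with `k ≥ 2` one has `k / 2 ≤ k - 1`,
  -- which absorbs the error `j / (2 * (T + 1)) ≤ k / 2` for `j > N`.
  refine ⟨B.toNat + 2, fun j hj => ?_⟩
  rcases le_or_gt j N with hjN | hjN
  · have := hB ⟨⟨j, by omega⟩, rfl⟩
    simp only at this
    push_cast
    linarith [Int.self_le_toNat B]
  · have h := hN j hjN.le
    have hj0 : (0 : ℝ) < j := by exact_mod_cast (Nat.zero_le N).trans_lt hjN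
    rw [lt_div_iff₀ hj0] at h
    set k : ℕ := B.toNat + 2 with hk
    have hk2 : (2 : ℝ) ≤ k := by rw [hk]; push_cast; linarith [Nat.cast_nonneg (α := ℝ) B.toNat]
    have hjk : (j : ℝ) ≤ k * (T + 1) := by
      have : (j : ℝ) ≤ k * T := by exact_mod_cast hj
      linarith
    have h1 : 1 / (2 * ((T : ℝ) + 1)) * j ≤ k / 2 := by
      rw [div_mul_eq_mul_div, one_mul, div_le_div_iff₀ (by positivity) two_pos]
      linarith
    have h2 : (r : ℝ) * j ≤ tInf ι Δ g * j := mul_le_mul_of_nonneg_right hr hj0.le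
    have h3 : (r : ℝ) * j + 1 - k ≤ ginf ι Δ (g ^ j) := by
      rw [sub_mul] at h
      linarith
    exact_mod_cast h3

theorem exists_isConj_le_ginf [Nontrivial M] (hM : IsGarsideMonoid M) (hΔ : IsGarsideElement Δ)
    (hι : IsGroupOfFractions ι) {g : G} {r : ℤ} (hr : (r : ℝ) ≤ tInf ι Δ g) :
    ∃ h : G, IsConj g h ∧ r ≤ ginf ι Δ h := by
  have := hM.cancel
  let _ := leftLattice hM hΔ hι
  have : MulLeftMono G := ⟨fun k _ _ h => GLeL.mul_left h k⟩
  obtain ⟨a, ha⟩ := exists_zpow_gLeL hM hΔ hι g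
  obtain ⟨b, hb⟩ := exists_gLeL_zpow hM hΔ hι g
  obtain ⟨u, hu⟩ := exists_conj_zpow_le (δ := ι Δ) (fun x y h n => GLeL.mul_zpow hΔ h n)
    (fun a b => finite_gLeL_zpow hM hι a b) (show GLeL ι 1 (ι Δ) from ⟨Δ, one_mul _⟩)
    (show ¬ GLeL ι (ι Δ) 1 from fun h => by
      have := le_of_gLeL hM hΔ hι (r := 1) (s := 0) (g := 1) (by simpa using h) ⟨1, by simp⟩
      omega)
    (r := r) ⟨ha, hb⟩ fun T => by
      obtain ⟨k, hk⟩ := exists_forall_le_ginf_pow hM hΔ hι hr T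
      exact ⟨k, fun j hj => zpow_gLeL_of_le_ginf hM hΔ hι (hk j hj)⟩
  exact ⟨u⁻¹ * g * u, isConj_iff.2 ⟨u⁻¹, by simp⟩, (isGreatest_ginf hM hΔ hι _).2 hu⟩

theorem exists_isConj_isInfStraight_iff [Nontrivial M] (hM : IsGarsideMonoid M)
    (hΔ : IsGarsideElement Δ) (hι : IsGroupOfFractions ι) (g : G) :
    (∃ h : G, IsConj g h ∧ IsInfStraight ι Δ h) ↔ ∃ k : ℤ, tInf ι Δ g = (k : ℝ) := by
  constructor
  · rintro ⟨h, hgh, hh⟩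
    exact ⟨ginf ι Δ h, (tInf_eq_of_isConj hM hΔ hι hgh).trans hh.symm⟩
  · rintro ⟨k, hk⟩
    obtain ⟨h, hgh, hle⟩ := exists_isConj_le_ginf hM hΔ hι hk.ge
    refine ⟨h, hgh, (ginf_le_tInf hM hΔ hι h).antisymm ?_⟩
    rw [← tInf_eq_of_isConj hM hΔ hι hgh, hk]
    exact_mod_cast hle

theorem tSup_eq_neg_tInf_inv [Nontrivial M] (hM : IsGarsideMonoid M) (hΔ : IsGarsideElement Δ)
    (hι : IsGroupOfFractions ι) (g : G) : tSup ι Δ g = -tInf ι Δ g⁻¹ := by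
  refine tendsto_nhds_unique (tendsto_tSup hM hΔ hι g) ?_
  simpa [gsup_eq_neg_ginf_inv hM hΔ hι, neg_div] using (tendsto_tInf hM hΔ hι g⁻¹).neg

theorem isSupStraight_iff_inv [Nontrivial M] (hM : IsGarsideMonoid M) (hΔ : IsGarsideElement Δ)
    (hι : IsGroupOfFractions ι) (g : G) : IsSupStraight ι Δ g ↔ IsInfStraight ι Δ g⁻¹ := by
  rw [IsSupStraight, IsInfStraight, tSup_eq_neg_tInf_inv hM hΔ hι,
    gsup_eq_neg_ginf_inv hM hΔ hι, Int.cast_neg, neg_inj]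

theorem exists_isConj_isSupStraight_iff [Nontrivial M] (hM : IsGarsideMonoid M)
    (hΔ : IsGarsideElement Δ) (hι : IsGroupOfFractions ι) (g : G) :
    (∃ h : G, IsConj g h ∧ IsSupStraight ι Δ h) ↔ ∃ k : ℤ, tSup ι Δ g = (k : ℝ) := by
  have hconj : ∀ {x y : G}, IsConj x y → IsConj x⁻¹ y⁻¹ := fun {x y} hxy => by
    obtain ⟨u, rfl⟩ := isConj_iff.1 hxy
    exact isConj_iff.2 ⟨u, by simp [mul_assoc]⟩
  have h := exists_isConj_isInfStraight_iff hM hΔ hι g⁻¹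
  rw [tSup_eq_neg_tInf_inv hM hΔ hι]
  constructor
  · rintro ⟨x, hx, hs⟩
    obtain ⟨k, hk⟩ := h.1 ⟨x⁻¹, hconj hx, (isSupStraight_iff_inv hM hΔ hι x).1 hs⟩
    exact ⟨-k, by rw [hk, Int.cast_neg]⟩
  · rintro ⟨k, hk⟩
    obtain ⟨x, hx, hs⟩ := h.2 ⟨-k, by rw [Int.cast_neg, ← hk, neg_neg]⟩
    exact ⟨x⁻¹, by simpa using hconj hx,
      (isSupStraight_iff_inv hM hΔ hι _).2 (by rwa [inv_inv])⟩

/-- In the degenerate case `M = {1}`, everything vanishes. -/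
theorem ginf_gsup_eq_zero_of_subsingleton [Subsingleton M] (hι : IsGroupOfFractions ι) (g : G) :
    ginf ι Δ g = 0 ∧ gsup ι Δ g = 0 := by
  have hG : ∀ x : G, x = 1 := fun x => by
    obtain ⟨a, b, rfl⟩ := hι.exists_fraction x
    rw [Subsingleton.elim a b, mul_inv_cancel]
  have h₁ : {r : ℤ | GLeL ι (ι Δ ^ r) g} = Set.univ :=
    Set.eq_univ_of_forall fun r => ⟨1, by rw [hG g, hG (_ * _)]⟩
  have h₂ : {r : ℤ | GLeL ι g (ι Δ ^ r)} = Set.univ :=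
    Set.eq_univ_of_forall fun r => ⟨1, by rw [hG (_ ^ _), hG (_ * _)]⟩
  rw [ginf, gsup, h₁, h₂]
  -- For unbounded sets of integers `sSup` and `sInf` default to `0`, in agreement with the
  -- convention for `M = {1}`.
  exact ⟨(csSup_of_not_bddAbove not_bddAbove_univ).trans Int.csSup_empty,
    (csInf_of_not_bddBelow not_bddBelow_univ).trans Int.csInf_empty⟩

theorem tInf_tSup_eq_zero_of_subsingleton [Subsingleton M] (hι : IsGroupOfFractions ι) (g : G) :
    tInf ι Δ g = 0 ∧ tSup ι Δ g = 0 := by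
  simp only [tInf, tSup, ginf_gsup_eq_zero_of_subsingleton hι, Int.cast_zero, zero_div]
  exact ⟨tendsto_const_nhds.limUnder_eq, tendsto_const_nhds.limUnder_eq⟩

end TranslationNumbers

end Garside

theorem corollary3p5 {M G : Type*} [Monoid M] [Group G] (hM : Garside.IsGarsideMonoid M)
    (Δ : M) (hΔ : Garside.IsGarsideElement Δ)
    (ι : M →* G) (hι : Garside.IsGroupOfFractions ι) (g : G) :
    ((∃ h : G, IsConj g h ∧ Garside.IsInfStraight ι Δ h) ↔
        ∃ k : ℤ, Garside.tInf ι Δ g = (k : ℝ)) ∧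
      ((∃ h : G, IsConj g h ∧ Garside.IsSupStraight ι Δ h) ↔
        ∃ k : ℤ, Garside.tSup ι Δ g = (k : ℝ)) := by
  rcases subsingleton_or_nontrivial M with _ | _
  · obtain ⟨hi, hs⟩ := Garside.ginf_gsup_eq_zero_of_subsingleton (Δ := Δ) hι g
    obtain ⟨ti, ts⟩ := Garside.tInf_tSup_eq_zero_of_subsingleton (Δ := Δ) hι g
    exact ⟨iff_of_true ⟨g, IsConj.refl g, by rw [Garside.IsInfStraight, hi, ti, Int.cast_zero]⟩
        ⟨0, by rw [ti, Int.cast_zero]⟩,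
      iff_of_true ⟨g, IsConj.refl g, by rw [Garside.IsSupStraight, hs, ts, Int.cast_zero]⟩
        ⟨0, by rw [ts, Int.cast_zero]⟩⟩
  · exact ⟨Garside.exists_isConj_isInfStraight_iff hM hΔ hι g,
      Garside.exists_isConj_isSupStraight_iff hM hΔ hι g⟩
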